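/- Let $G$ be a finite simple graph. A matching of $G$ is a set of pairwise non-adjacent edges, and the matching polytope $\mathcal M_G\subset\mathbb R^{E(G)}$ is the convex hull of the $(0,1)$-indicator vectors of all matchings of $G$. Let $G'$ be an odd subdivision of $G$, i.e. a graph obtained from $G$ by replacing each edge by a path of odd length (length $1$ allowed, the paths being internally disjoint with new inner vertices). Then $\mathcal M_{G'}$ has a face $F$ that is unimodularly isomorphic to $\mathcal M_G$: there is an affine isomorphism from the affine hull of $F$ onto the affine hull of $\mathcal M_G$ that maps $F$ onto $\mathcal M_G$ and the integer points of the first affine hull onto the integer points of the second. Moreover, for every field $\mathbb K$, $$\omega(I_{\mathcal M_G})\le\omega(I_{\mathcal M_{G'}}).$$ Here, for a lattice polytope $\mathcal P\subset\mathbb R^m_{\ge 0}$, $I_{\mathcal P}$ is the toric ideal of $\mathcal P$, the kernel of the homomorphism $\mathbb K[x_{\mathbf a}:\mathbf a\in\mathcal P\cap\mathbb Z^m]\to\mathbb K[t_1,\dots,t_m,s]$, $x_{\mathbf a}\mapsto \mathbf t^{\mathbf a}s$, and for a homogeneous ideal $I$ (every variable having degree $1$), $\omega(I)$ is the maximal degree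 of an element of a minimal system of homogeneous generators of $I$, with the convention $\omega(\{0\})=2$. -/

import Mathlib

/-- A subdivision of the simple graph `G` in which every edge is replaced by a path of odd length,
realized as the simple graph `G'`: the vertices of `G` are embedded in `G'`, each edge of `G` is
replaced by a path of odd length between the images of its ends, the paths have no common vertices
except at their ends, and `G'` has no other vertices and edges. -/
structure OddSubdivision {V W : Type*} (G : SimpleGraph V) (G' : SimpleGraph W) where
  /-- the embedding of the original vertices -/
  vert : V ↪ W
  /-- the path that replaces the edge `uv`, traversed from `u` to `v` -/
  path : ∀ {u v : V}, G.Adj u v → G'.Walk (vert u) (vert v)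
  isPath : ∀ {u v : V} (h : G.Adj u v), (path h).IsPath
  odd_length : ∀ {u v : V} (h : G.Adj u v), Odd (path h).length
  /-- there is one path for each edge: the other direction gives the same path reversed -/
  path_symm : ∀ {u v : V} (h : G.Adj u v), path h.symm = (path h).reverse
  /-- the inner vertices of the paths are new vertices -/
  inner_new : ∀ {u v : V} (h : G.Adj u v) (x : V),
    vert x ∈ (path h).support → x = u ∨ x = v
  /-- the paths of different edges share no new vertex -/
  inner_disjoint : ∀ {u v x y : V} (h : G.Adj u v) (k : G.Adj x y), s(u, v) ≠ s(x, y) →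
    ∀ w, w ∈ (path h).support → w ∈ (path k).support → w ∈ Set.range vert
  /-- every vertex of `G'` is an original vertex or lies on one of the paths -/
  vertex_cover : ∀ w : W, w ∈ Set.range vert ∨
    ∃ (u v : V) (h : G.Adj u v), w ∈ (path h).support
  /-- every edge of `G'` lies on one of the paths -/
  edge_cover : ∀ e ∈ G'.edgeSet, ∃ (u v : V) (h : G.Adj u v), e ∈ (path h).edges

/-- `G'` is (up to renaming its vertices) an odd subdivision of `G`. -/
def IsOddSubdivision {V W : Type*} (G : SimpleGraph V) (G' : SimpleGraph W) : Prop :=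
  Nonempty (OddSubdivision G G')

/-- The (full) matching polytope of `G` in `ℝ^E(G)`: the convex hull of the `(0,1)`-vectors of the
matchings of `G`, that is, of the sets of pairwise non-adjacent edges. -/
def matchingPolytope {V : Type*} (G : SimpleGraph V) : Set (G.edgeSet → ℝ) :=
  convexHull ℝ
    {x | ∃ M : Set G.edgeSet, G.lineGraph.IsIndepSet M ∧ x = M.indicator (fun _ => (1 : ℝ))}

/-- The lattice `ℤ^ι` in `ℝ^ι`. -/
def integerPoints (ι : Type*) : Set (ι → ℝ) :=
  {x | ∀ i, ∃ n : ℤ, x i = n}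

/-- `P ⊆ ℝ^ι` and `Q ⊆ ℝ^κ` are unimodularly isomorphic: there is an affine isomorphism between
their affine hulls that carries `P` onto `Q` and the lattice points of the affine hull of `P` onto
those of the affine hull of `Q`. The isomorphism is given by an affine map of the ambient spaces,
of which only the restriction to the affine hull of `P` matters; it is onto the affine hull of `Q`
as `P` is mapped onto `Q`. -/
def UnimodularlyIsomorphic {ι κ : Type*} (P : Set (ι → ℝ)) (Q : Set (κ → ℝ)) : Prop :=
  ∃ f : (ι → ℝ) →ᵃ[ℝ] (κ → ℝ),
    Set.InjOn f (affineSpan ℝ P : Set (ι → ℝ)) ∧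
    f '' P = Q ∧
    f '' ((affineSpan ℝ P : Set (ι → ℝ)) ∩ integerPoints ι) =
      (affineSpan ℝ Q : Set (κ → ℝ)) ∩ integerPoints κ

/-- The points of `P ∩ ℤ^ι` with nonnegative coordinates (for finite `ι`). -/
def LatticePoint {ι : Type*} (P : Set (ι → ℝ)) : Type _ :=
  {a : ι →₀ ℕ // (fun i => (a i : ℝ)) ∈ P}

/-- The homomorphism `K[x_a : a ∈ P ∩ ℤ^ι] → K[t, s]`, `x_a ↦ t^a s`; the variable `t_i` is
`X (some i)`, the variable `s` is `X none`. Its image is the toric ring of `P`. -/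
noncomputable def toricMap (K : Type*) [Field K] {ι : Type*} (P : Set (ι → ℝ)) :
    MvPolynomial (LatticePoint P) K →ₐ[K] MvPolynomial (Option ι) K :=
  MvPolynomial.aeval fun a =>
    MvPolynomial.rename some (MvPolynomial.monomial a.1 1) * MvPolynomial.X none

/-- The toric ideal of a lattice polytope `P`. -/
noncomputable def toricIdeal (K : Type*) [Field K] {ι : Type*} (P : Set (ι → ℝ)) :
    Ideal (MvPolynomial (LatticePoint P) K) :=
  RingHom.ker (toricMap K P)

/-- `S` is a minimal system of homogeneous generators of `I` (every variable has degree `1`). -/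
structure IsMinimalGenerators {σ K : Type*} [Field K] (I : Ideal (MvPolynomial σ K))
    (S : Set (MvPolynomial σ K)) : Prop where
  homogeneous : ∀ f ∈ S, ∃ n : ℕ, f.IsHomogeneous n
  span_eq : Ideal.span S = I
  minimal : ∀ T, T ⊂ S → Ideal.span T ≠ I

open Classical in
/-- `ω(I)`, the maximal degree of minimal generators of the homogeneous ideal `I`, with the
convention `ω(0) = 2`. (The degrees that occur are the same for all minimal systems of homogeneous
generators. The value is finite when `I` is homogeneous and there are finitely many variables;
`ℕ∞` only avoids a junk value of the supremum.) -/
noncomputable def omegaDegree {σ K : Type*} [Field K] (I : Ideal (MvPolynomial σ K)) : ℕ∞ :=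
  if I = ⊥ then 2
  else sSup {d : ℕ∞ | ∃ S, IsMinimalGenerators I S ∧ ∃ f ∈ S, d = (f.totalDegree : ℕ∞)}

/-! Matchings are the independent sets of the line graph, so the proof works with stable set
polytopes. In the line graph of `G'` each edge of `G` has become a path with an odd number of
vertices, and different paths are joined only at vertices in odd position; `VertexInflation` records
this. The face `F` is cut out by `x e' + x f' = 1` for consecutive vertices of a path. Along a path
the coordinates then alternate `t, 1 - t, t, ...`, so the first ones determine the rest, and by
oddness both ends carry `t`: the constraints between paths are exactly those of `G`. Restriction to
first coordinates is therefore the unimodular isomorphism (`unimodularlyIsomorphic_face`).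

For `ω`, `faceHom` kills the variables off the face and has the inclusion of the face variables as a
section. Both maps respect the toric ideals, so `faceHom` carries that of `G'` onto that of `G`.
Images of homogeneous generators generate the image ideal in the same degrees, and no minimal
generator exceeds the degrees of a given generating system (`omegaDegree_map_le`). The convention
`ω(0) = 2` is harmless because toric ideals contain no nonzero forms of degree below two. -/

namespace MvPolynomial

-- Degrees of minimal generators of homogeneous ideals.

attribute [local instance] MvPolynomial.gradedAlgebra

variable {σ τ K : Type*} [Field K]

lemma coe_decompose_homogeneousSubmodule (f : MvPolynomial σ K) (n : ℕ) :
    (DirectSum.decompose (homogeneousSubmodule σ K) f n : MvPolynomial σ K) =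
      homogeneousComponent n f :=
  decomposition.decompose'_apply f n

lemma homogeneousComponent_mul_eq_zero {f : MvPolynomial σ K} {n k : ℕ} (hf : f.IsHomogeneous n)
    (hk : k < n) (a : MvPolynomial σ K) : homogeneousComponent k (a * f) = 0 := by
  rw [← coe_decompose_homogeneousSubmodule]
  exact DirectSum.coe_decompose_mul_of_right_mem_of_not_le (homogeneousSubmodule σ K)
    ((mem_homogeneousSubmodule n f).2 hf) (not_le.2 hk)

lemma homogeneousComponent_mem_span {S : Set (MvPolynomial σ K)}
    (hS : ∀ f ∈ S, ∃ n : ℕ, f.IsHomogeneous n) {f : MvPolynomial σ K} (hf : f ∈ Ideal.span S)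
    (n : ℕ) : homogeneousComponent n f ∈ Ideal.span S := by
  have h : (Ideal.span S).IsHomogeneous (homogeneousSubmodule σ K) :=
    Ideal.homogeneous_span _ S fun x hx => (hS x hx).imp fun n hn =>
      (mem_homogeneousSubmodule n x).2 hn
  have := h n hf
  rwa [coe_decompose_homogeneousSubmodule] at this

/-- An ideal closed under homogeneous components in finitely many variables has a minimal
system of homogeneous generators. -/
lemma exists_isMinimalGenerators [Finite σ] {I : Ideal (MvPolynomial σ K)}
    (hI : ∀ f ∈ I, ∀ n, homogeneousComponent n f ∈ I) : ∃ S, IsMinimalGenerators I S := by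
  have hspan : Ideal.span {f | f ∈ I ∧ ∃ n : ℕ, f.IsHomogeneous n} = I := by
    refine le_antisymm (Ideal.span_le.2 fun f hf => hf.1) fun f hf => ?_
    rw [← sum_homogeneousComponent f]
    exact Ideal.sum_mem _ fun n _ =>
      Ideal.subset_span ⟨hI f hf n, n, homogeneousComponent_isHomogeneous n f⟩
  have hfg : (Ideal.span {f | f ∈ I ∧ ∃ n : ℕ, f.IsHomogeneous n}).FG := IsNoetherian.noetherian _
  obtain ⟨T, hTsub, hT⟩ := (Submodule.fg_span_iff_fg_span_finset_subset _).1 hfg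
  obtain ⟨S, ⟨hS1, hS2⟩, hSmin⟩ := exists_minimal_of_wellFoundedLT
    (fun S : Finset (MvPolynomial σ K) =>
      (∀ f ∈ S, ∃ n : ℕ, f.IsHomogeneous n) ∧ Ideal.span (S : Set (MvPolynomial σ K)) = I)
    ⟨T, fun f hf => (hTsub hf).2, hT.symm.trans hspan⟩
  refine ⟨S, hS1, hS2, fun U hU hUI => ?_⟩
  obtain ⟨U, rfl⟩ := (S.finite_toSet.subset hU.1).exists_finset_coe
  exact hU.2 (hSmin ⟨fun f hf => hS1 f (hU.1 hf), hUI⟩ hU.1)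

/-- If every `g ∈ T` had smaller degree than `f`, a multiple of `f` could not contribute to the
degree of `g`; then `S \ {f}` would generate all of `T`, against minimality. -/
lemma exists_le_totalDegree_of_isMinimalGenerators {I : Ideal (MvPolynomial σ K)}
    {S T : Set (MvPolynomial σ K)} (hS : IsMinimalGenerators I S)
    (hT : ∀ g ∈ T, ∃ n : ℕ, g.IsHomogeneous n) (hTI : Ideal.span T = I)
    {f : MvPolynomial σ K} (hf : f ∈ S) : ∃ g ∈ T, f.totalDegree ≤ g.totalDegree := by
  by_contra! hlt
  have hne : f ≠ 0 ∨ T = ∅ := by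
    rcases T.eq_empty_or_nonempty with h | ⟨g, hg⟩
    · exact Or.inr h
    · refine Or.inl ?_
      rintro rfl
      simpa using hlt g hg
  have hssub : S \ {f} ⊂ S := ⟨Set.sdiff_subset, fun h => (h hf).2 rfl⟩
  refine hS.minimal _ hssub
    (le_antisymm ((Ideal.span_mono Set.sdiff_subset).trans hS.span_eq.le) ?_)
  rw [← hTI, Ideal.span_le]
  intro g hg
  have hf0 : f ≠ 0 := hne.resolve_right (Set.nonempty_iff_ne_empty.1 ⟨g, hg⟩)
  by_cases hg0 : g = 0
  · rw [hg0]; exact Submodule.zero_mem _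
  obtain ⟨n, hn⟩ := hS.homogeneous f hf
  obtain ⟨k, hk⟩ := hT g hg
  have hkn : k < n := by
    rw [← hn.totalDegree hf0, ← hk.totalDegree hg0]; exact hlt g hg
  have hgS : g ∈ Ideal.span (insert f (S \ {f})) := by
    rw [Set.insert_sdiff_singleton, Set.insert_eq_of_mem hf, hS.span_eq, ← hTI]
    exact Ideal.subset_span hg
  obtain ⟨a, b, hb, hab⟩ := Ideal.mem_span_insert.1 hgS
  have := homogeneousComponent_mem_span (fun x hx => hS.homogeneous x hx.1) hb k
  rw [← homogeneousComponent_eq_self hk, hab, map_add, homogeneousComponent_mul_eq_zero hn hkn a, zero_add]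
  exact this

lemma le_omegaDegree {I : Ideal (MvPolynomial σ K)} {S : Set (MvPolynomial σ K)}
    (hS : IsMinimalGenerators I S) (hI : I ≠ ⊥) {f : MvPolynomial σ K} (hf : f ∈ S) :
    (f.totalDegree : ℕ∞) ≤ omegaDegree I := by
  rw [omegaDegree, if_neg hI]
  exact le_sSup ⟨S, hS, f, hf, rfl⟩

/-- A ring homomorphism that preserves degrees and maps one ideal onto another does not
increase `ω`, provided the first ideal contains no forms of degree less than two. -/
lemma omegaDegree_map_le [Finite σ] {I : Ideal (MvPolynomial σ K)} {J : Ideal (MvPolynomial τ K)}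
    (hI : ∀ f ∈ I, ∀ n, homogeneousComponent n f ∈ I)
    (hI2 : ∀ f ∈ I, ∀ n < 2, f.IsHomogeneous n → f = 0)
    (π : MvPolynomial σ K →+* MvPolynomial τ K) (hπ : I.map π = J)
    (hdeg : ∀ (f : MvPolynomial σ K) (n : ℕ), f.IsHomogeneous n → (π f).IsHomogeneous n) :
    omegaDegree J ≤ omegaDegree I := by
  by_cases hI0 : I = ⊥
  · have hJ0 : J = ⊥ := by rw [← hπ, hI0, Ideal.map_bot]
    simp [omegaDegree, hI0, hJ0]
  obtain ⟨S, hS⟩ := exists_isMinimalGenerators hI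
  by_cases hJ0 : J = ⊥
  · rw [omegaDegree, if_pos hJ0]
    have hSne : ∃ f ∈ S, f ≠ 0 := by
      by_contra! h
      exact hI0 (hS.span_eq ▸ Ideal.span_eq_bot.2 h)
    obtain ⟨f, hf, hf0⟩ := hSne
    obtain ⟨n, hn⟩ := hS.homogeneous f hf
    refine le_trans ?_ (le_omegaDegree hS hI0 hf)
    have hfI : f ∈ I := hS.span_eq ▸ Ideal.subset_span hf
    rw [hn.totalDegree hf0]
    by_contra! hlt
    exact hf0 (hI2 f hfI n (by exact_mod_cast hlt) hn)
  · rw [omegaDegree, if_neg hJ0]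
    refine sSup_le ?_
    rintro _ ⟨T, hT, f, hf, rfl⟩
    obtain ⟨_, ⟨g, hg, rfl⟩, hle⟩ := exists_le_totalDegree_of_isMinimalGenerators hT (T := π '' S)
      (by rintro _ ⟨g, hg, rfl⟩; exact (hS.homogeneous g hg).imp (hdeg g))
      (by rw [← Ideal.map_span, hS.span_eq, hπ]) hf
    refine le_trans ?_ (le_omegaDegree hS hI0 hg)
    obtain ⟨n, hn⟩ := hS.homogeneous g hg
    -- `π` may kill a generator; the bound then forces `f` to have degree `0`.
    rcases eq_or_ne (π g) 0 with h0 | h0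
    · rw [h0, totalDegree_zero, Nat.le_zero] at hle
      rw [hle]; exact bot_le
    · have hg0 : g ≠ 0 := by rintro rfl; exact h0 (map_zero π)
      rw [(hdeg g n hn).totalDegree h0] at hle
      rw [hn.totalDegree hg0]
      exact_mod_cast hle

end MvPolynomial

open MvPolynomial

/-! ### Grading of the toric ideal. -/

section ToricIdeal

variable {K : Type*} [Field K] {ι : Type*}

/-- The exponent of the image of the monomial with exponent `m` under the toric map. -/
noncomputable def toricExponent {P : Set (ι → ℝ)} (m : LatticePoint P →₀ ℕ) : Option ι →₀ ℕ :=
  m.sum fun a k => k • (Finsupp.mapDomain some a.1 + Finsupp.single none 1)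

lemma toricExponent_some {P : Set (ι → ℝ)} (m : LatticePoint P →₀ ℕ) (i : ι) :
    toricExponent m (some i) = m.sum fun a k => k * a.1 i := by
  simp [toricExponent, Finsupp.sum, Finsupp.finsetSum_apply,
    Finsupp.mapDomain_apply (Option.some_injective ι)]

lemma toricExponent_none {P : Set (ι → ℝ)} (m : LatticePoint P →₀ ℕ) :
    toricExponent m none = m.sum fun _ k => k := by
  have h (a : ι →₀ ℕ) : Finsupp.mapDomain some a (none : Option ι) = 0 :=
    Finsupp.mapDomain_of_notMem_range _ _ (by simp)
  simp [toricExponent, Finsupp.sum, Finsupp.finsetSum_apply, h]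

lemma toricExponent_none_eq_degree {P : Set (ι → ℝ)} (m : LatticePoint P →₀ ℕ) :
    toricExponent m none = m.degree := by
  rw [toricExponent_none]; rfl

lemma toricMap_monomial {P : Set (ι → ℝ)} (m : LatticePoint P →₀ ℕ) :
    toricMap K P (monomial m 1) = monomial (toricExponent m) 1 := by
  simp only [toricMap, aeval_monomial, map_one, one_mul, rename_monomial, X, monomial_mul,
    monomial_pow, one_pow, mul_one, toricExponent]
  rw [Finsupp.prod, Finsupp.sum, monomial_sum_one]

/-- The linear map of polynomials with prescribed values at the monomials. -/
noncomputable def monomialLinearMap {σ M : Type*} [AddCommMonoid M] [Module K M]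
    (g : (σ →₀ ℕ) → M) : MvPolynomial σ K →ₗ[K] M :=
  (basisMonomials σ K).constr K g

lemma monomialLinearMap_monomial {σ M : Type*} [AddCommMonoid M] [Module K M]
    (g : (σ →₀ ℕ) → M) (m : σ →₀ ℕ) : monomialLinearMap (K := K) g (monomial m 1) = g m := by
  have := (basisMonomials σ K).constr_basis K g m
  rwa [coe_basisMonomials] at this

lemma linearMap_ext_monomial {σ M : Type*} [AddCommMonoid M] [Module K M]
    {f g : MvPolynomial σ K →ₗ[K] M} (h : ∀ m, f (monomial m 1) = g (monomial m 1)) : f = g :=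
  (basisMonomials σ K).ext fun m => by simpa using h m

lemma mem_toricIdeal {P : Set (ι → ℝ)} {f : MvPolynomial (LatticePoint P) K} :
    f ∈ toricIdeal K P ↔ toricMap K P f = 0 := Iff.rfl

lemma homogeneousComponent_monomial_one {σ : Type*} (n : ℕ) (m : σ →₀ ℕ) :
    homogeneousComponent n (monomial m (1 : K)) = if m.degree = n then monomial m 1 else 0 := by
  rw [homogeneousComponent_of_mem (isHomogeneous_monomial 1 rfl)]
  simp only [eq_comm]

/-- The exponent of `s` records the degree, so taking a component corresponds to a linear selection
of monomials after the toric map. A linear map that factors in this way preserves the kernel; the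
same device recurs below. -/
lemma homogeneousComponent_mem_toricIdeal {P : Set (ι → ℝ)}
    {f : MvPolynomial (LatticePoint P) K} (hf : f ∈ toricIdeal K P) (n : ℕ) :
    homogeneousComponent n f ∈ toricIdeal K P := by
  have h : (toricMap K P).toLinearMap ∘ₗ homogeneousComponent n =
      monomialLinearMap (K := K) (fun b => if b none = n then monomial b (1 : K) else 0) ∘ₗ
        (toricMap K P).toLinearMap := by
    refine linearMap_ext_monomial fun m => ?_
    simp only [LinearMap.comp_apply, AlgHom.toLinearMap_apply, toricMap_monomial,
      monomialLinearMap_monomial, homogeneousComponent_monomial_one, toricExponent_none_eq_degree]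
    split_ifs
    · exact toricMap_monomial m
    · exact map_zero _
  have := LinearMap.congr_fun h f
  simp only [LinearMap.comp_apply, AlgHom.toLinearMap_apply, mem_toricIdeal.1 hf, map_zero] at this
  exact mem_toricIdeal.2 this

lemma toricExponent_injOn {P : Set (ι → ℝ)} {m m' : LatticePoint P →₀ ℕ} (hm : m.degree < 2)
    (hmm' : m'.degree = m.degree) (h : toricExponent m = toricExponent m') : m = m' := by
  obtain h0 | h1 : m.degree = 0 ∨ m.degree = 1 := by omega
  · rw [(Finsupp.degree_eq_zero_iff m).1 h0, (Finsupp.degree_eq_zero_iff m').1 (hmm'.trans h0)]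
  · obtain ⟨a, rfl⟩ := (Finsupp.sum_eq_one_iff m).1 h1
    obtain ⟨b, rfl⟩ := (Finsupp.sum_eq_one_iff m').1 (hmm'.trans h1)
    congr 1
    refine Subtype.ext (Finsupp.ext fun i => ?_)
    have := DFunLike.congr_fun h (some i)
    simpa [toricExponent_some] using this

open Classical in
-- In degrees `0` and `1` distinct monomials have distinct images, so nothing can cancel.
lemma eq_zero_of_mem_toricIdeal_of_isHomogeneous {P : Set (ι → ℝ)}
    {f : MvPolynomial (LatticePoint P) K} (hf : f ∈ toricIdeal K P) {n : ℕ} (hn : n < 2)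
    (hfn : f.IsHomogeneous n) : f = 0 := by
  have hT : toricMap K P f = f.support.sum fun m => monomial (toricExponent m) (coeff m f) := by
    conv_lhs => rw [f.as_sum, map_sum]
    refine Finset.sum_congr rfl fun m _ => ?_
    have hmon (σ : Type _) (s : σ →₀ ℕ) (c : K) : monomial s c = c • monomial s (1 : K) := by
      simp [smul_monomial]
    rw [hmon _ m, map_smul, toricMap_monomial, ← hmon]
  rw [mem_toricIdeal.1 hf] at hT
  have hdeg {m : LatticePoint P →₀ ℕ} (hm : m ∈ f.support) : m.degree = n := by
    rw [Finsupp.degree_eq_weight_one]; exact hfn (mem_support_iff.1 hm)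
  by_contra hf0
  obtain ⟨m, hm⟩ := support_nonempty.2 hf0
  have := congrArg (coeff (toricExponent m)) hT
  rw [coeff_zero, coeff_sum, Finset.sum_eq_single m, coeff_monomial, if_pos rfl] at this
  · exact mem_support_iff.1 hm this.symm
  · intro m' hm' hne
    rw [coeff_monomial, if_neg]
    intro h
    exact hne (toricExponent_injOn (by rw [hdeg hm']; exact hn) (by rw [hdeg hm, hdeg hm']) h)
  · exact fun h => absurd hm h

end ToricIdeal

/-! ### Stable set polytopes and their lattice points. -/

section StablePolytope

variable {E : Type*} {H : SimpleGraph E}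

/-- The stable set polytope of a graph: the convex hull of the `(0,1)`-vectors of its
independent sets. -/
def stablePolytope (H : SimpleGraph E) : Set (E → ℝ) :=
  convexHull ℝ {x | ∃ M : Set E, H.IsIndepSet M ∧ x = M.indicator (fun _ => (1 : ℝ))}

lemma matchingPolytope_eq_stablePolytope {V : Type*} (G : SimpleGraph V) :
    matchingPolytope G = stablePolytope G.lineGraph := rfl

lemma le_one_of_mem_stablePolytope {x : E → ℝ} (hx : x ∈ stablePolytope H) (e : E) : x e ≤ 1 := by
  have h : stablePolytope H ⊆ {x | LinearMap.proj (R := ℝ) (φ := fun _ : E => ℝ) e x ≤ 1} := by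
    refine convexHull_min ?_ (convex_halfSpace_le (LinearMap.isLinear _) 1)
    rintro _ ⟨M, -, rfl⟩
    by_cases he : e ∈ M <;> simp [he]
  exact h hx

lemma add_le_one_of_mem_stablePolytope {x : E → ℝ} (hx : x ∈ stablePolytope H) {e f : E}
    (hef : H.Adj e f) : x e + x f ≤ 1 := by
  have h : stablePolytope H ⊆ {x | (LinearMap.proj (R := ℝ) (φ := fun _ : E => ℝ) e +
      LinearMap.proj (R := ℝ) (φ := fun _ : E => ℝ) f) x ≤ 1} := by
    refine convexHull_min ?_ (convex_halfSpace_le (LinearMap.isLinear _) 1)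
    rintro _ ⟨M, hM, rfl⟩
    have : ¬ (e ∈ M ∧ f ∈ M) := fun h => hM h.1 h.2 hef.ne hef
    by_cases he : e ∈ M <;> by_cases hf : f ∈ M <;> simp_all
  exact h hx

/-- The edge inequalities do not describe the polytope in general, but they do single out its
lattice points, which is all that is needed. The bound by `1` is separate because of isolated
vertices. -/
lemma natCast_mem_stablePolytope_iff {a : E → ℕ} :
    (fun e => (a e : ℝ)) ∈ stablePolytope H ↔
      (∀ e, a e ≤ 1) ∧ ∀ e f, H.Adj e f → a e + a f ≤ 1 := by
  refine ⟨fun h => ⟨fun e => ?_, fun e f hef => ?_⟩, fun ⟨h1, h2⟩ => ?_⟩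
  · exact_mod_cast le_one_of_mem_stablePolytope h e
  · exact_mod_cast add_le_one_of_mem_stablePolytope h hef
  · refine subset_convexHull ℝ _ ⟨{e | a e = 1}, fun e he f hf _ hef => ?_, funext fun e => ?_⟩
    · have := h2 e f hef
      simp only [Set.mem_ofPred_eq] at he hf
      omega
    · obtain h | h : a e = 0 ∨ a e = 1 := by have := h1 e; omega
      all_goals simp [Set.indicator, h]

lemma finite_latticePoint_stablePolytope [Finite E] (H : SimpleGraph E) :
    Finite (LatticePoint (stablePolytope H)) := by
  refine Finite.of_injective (fun a : LatticePoint (stablePolytope H) => {e | a.1 e = 1})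
    fun a b hab => Subtype.ext (Finsupp.ext fun e => ?_)
  have ha := (natCast_mem_stablePolytope_iff.1 a.2).1 e
  have hb := (natCast_mem_stablePolytope_iff.1 b.2).1 e
  have : a.1 e = 1 ↔ b.1 e = 1 := Set.ext_iff.1 hab e
  omega

/-- A point of a convex hull at which a linear form attains its maximum over the generators is a
convex combination of generators with the same property. -/
lemma mem_convexHull_of_linearMap_eq {F : Type*} [AddCommGroup F] [Module ℝ F] (l : F →ₗ[ℝ] ℝ)
    {c : ℝ} {s : Set F} (hs : ∀ x ∈ s, l x ≤ c) {x : F} (hx : x ∈ convexHull ℝ s) (hxc : l x = c) :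
    x ∈ convexHull ℝ {y | y ∈ s ∧ l y = c} := by
  have h : convexHull ℝ s ⊆
      {x | l x ≤ c ∧ (l x = c → x ∈ convexHull ℝ {y | y ∈ s ∧ l y = c})} := by
    refine convexHull_min (fun x hx => ⟨hs x hx, fun h => subset_convexHull ℝ _ ⟨hx, h⟩⟩) ?_
    -- Positive weights can be cancelled, so equality at the combination forces equality at both
    -- points.
    rw [convex_iff_forall_pos]
    rintro y ⟨hy, hy'⟩ z ⟨hz, hz'⟩ a b ha hb hab
    have hl : l (a • y + b • z) = a * l y + b * l z := by simp
    have hc : a * c + b * c = c := by rw [← add_mul, hab, one_mul]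
    have h1 := mul_le_mul_of_nonneg_left hy ha.le
    have h2 := mul_le_mul_of_nonneg_left hz hb.le
    refine ⟨by linarith, fun h => ?_⟩
    have hyc : l y = c := by
      refine hy.antisymm (le_of_mul_le_mul_left ?_ ha); linarith
    have hzc : l z = c := by
      refine hz.antisymm (le_of_mul_le_mul_left ?_ hb); linarith
    exact convex_convexHull ℝ _ (hy' hyc) (hz' hzc) ha.le hb.le hab
  exact (h hx).2 hxc

end StablePolytope

/-- Combinatorial data relating a graph `H` to a graph `H'` in which each vertex of `H` is
replaced by a path with an odd number of vertices, so that the edges of `H` are realized between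
vertices of the paths in odd position. It describes the line graphs of a graph and of an odd
subdivision of it. -/
structure VertexInflation {E E' : Type*} (H : SimpleGraph E) (H' : SimpleGraph E') where
  /-- the vertex replaced by the path through the given vertex -/
  proj : E' → E
  /-- the vertices in odd position -/
  odd : E' → Prop
  /-- the first vertex of a path -/
  base : E → E'
  proj_base : ∀ e, proj (base e) = e
  odd_base : ∀ e, odd (base e)
  adj : ∀ {e' f' : E'}, H'.Adj e' f' →
    (proj e' = proj f' ∧ (odd e' ↔ ¬ odd f')) ∨ (H.Adj (proj e') (proj f') ∧ odd e' ∧ odd f')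
  lift_adj : ∀ {e f : E}, H.Adj e f →
    ∃ e' f', H'.Adj e' f' ∧ proj e' = e ∧ proj f' = f ∧ odd e' ∧ odd f'
  -- Required for all real `x`, so that it applies on the affine hull of the face and not only on
  -- the face.
  alternate : ∀ x : E' → ℝ, (∀ e' f', H'.Adj e' f' → proj e' = proj f' → x e' + x f' = 1) →
    ∀ e', (odd e' → x e' = x (base (proj e'))) ∧ (¬ odd e' → x e' = 1 - x (base (proj e')))

/-! ### The face and its unimodular isomorphism. -/

namespace VertexInflation

variable {E E' : Type*} {H : SimpleGraph E} {H' : SimpleGraph E'} (D : VertexInflation H H')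

/-- The face of the stable set polytope on which consecutive vertices of the paths have
coordinate sum `1`. -/
def face : Set (E' → ℝ) :=
  {x | x ∈ stablePolytope H' ∧ ∀ e' f', H'.Adj e' f' → D.proj e' = D.proj f' → x e' + x f' = 1}

open Classical in
/-- The `(0,1)`-vector on `E'` that corresponds to the `(0,1)`-vector `a` on `E`. -/
noncomputable def inflate (a : E → ℕ) (e' : E') : ℕ :=
  -- The truncated subtraction is a genuine one when `a ≤ 1`.
  if D.odd e' then a (D.proj e') else 1 - a (D.proj e')

lemma inflate_base (a : E → ℕ) (e : E) : D.inflate a (D.base e) = a e := by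
  rw [inflate, if_pos (D.odd_base e), D.proj_base]

lemma inflate_add_inflate {a : E → ℕ} (ha : ∀ e, a e ≤ 1) {e' f' : E'} (h : H'.Adj e' f')
    (hp : D.proj e' = D.proj f') : D.inflate a e' + D.inflate a f' = 1 := by
  have h1 := ha (D.proj f')
  obtain ⟨-, h2⟩ | ⟨h2, -⟩ := D.adj h
  · unfold inflate
    rw [hp]
    split_ifs <;> first | omega | tauto
  · exact absurd hp h2.ne

lemma inflate_mem_stablePolytope {a : E → ℕ} (ha : (fun e => (a e : ℝ)) ∈ stablePolytope H) :
    (fun e' => (D.inflate a e' : ℝ)) ∈ stablePolytope H' := by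
  obtain ⟨h1, h2⟩ := natCast_mem_stablePolytope_iff.1 ha
  refine natCast_mem_stablePolytope_iff.2 ⟨fun e' => ?_, fun e' f' h => ?_⟩
  · have := h1 (D.proj e')
    unfold inflate
    split_ifs <;> omega
  · obtain ⟨hp, -⟩ | ⟨hp, he, hf⟩ := D.adj h
    · exact (D.inflate_add_inflate h1 h hp).le
    · simpa [inflate, he, hf] using h2 _ _ hp

lemma inflate_mem_face {a : E → ℕ} (ha : (fun e => (a e : ℝ)) ∈ stablePolytope H) :
    (fun e' => (D.inflate a e' : ℝ)) ∈ D.face :=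
  ⟨D.inflate_mem_stablePolytope ha, fun e' f' h hp => by
    beta_reduce
    exact_mod_cast D.inflate_add_inflate (natCast_mem_stablePolytope_iff.1 ha).1 h hp⟩

lemma inflate_comp_base {a : E' → ℕ} (ha : (fun e => (a e : ℝ)) ∈ D.face) :
    D.inflate (a ∘ D.base) = a := by
  funext e'
  have h1 := (natCast_mem_stablePolytope_iff.1 ha.1).1 (D.base (D.proj e'))
  obtain ⟨h2, h3⟩ := D.alternate _ ha.2 e'
  unfold inflate
  split_ifs with h
  · exact_mod_cast (h2 h).symm
  · have := h3 h
    rw [← Nat.cast_one, ← Nat.cast_sub h1] at this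
    exact_mod_cast this.symm

lemma comp_base_mem_stablePolytope {a : E' → ℕ} (ha : (fun e => (a e : ℝ)) ∈ D.face) :
    (fun e => (a (D.base e) : ℝ)) ∈ stablePolytope H := by
  obtain ⟨h1, h2⟩ := natCast_mem_stablePolytope_iff.1 ha.1
  refine natCast_mem_stablePolytope_iff.2 ⟨fun e => h1 _, fun e f h => ?_⟩
  obtain ⟨e', f', hadj, rfl, rfl, he, hf⟩ := D.lift_adj h
  have h3 : (a e' : ℝ) = a (D.base (D.proj e')) := (D.alternate _ ha.2 e').1 he
  have h4 : (a f' : ℝ) = a (D.base (D.proj f')) := (D.alternate _ ha.2 f').1 hf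
  rw [← Nat.cast_inj.1 h3, ← Nat.cast_inj.1 h4]
  exact h2 _ _ hadj

open Classical in
-- Sum the valid inequalities `x e' + x f' ≤ 1` along the paths: the sum is tight only if each of
-- them is. Ordered pairs count each twice, harmlessly.
lemma exists_linearMap [Finite E'] : ∃ (l : (E' → ℝ) →ₗ[ℝ] ℝ) (c : ℝ),
    (∀ x ∈ stablePolytope H', l x ≤ c) ∧ ∀ x ∈ stablePolytope H', l x = c ↔ x ∈ D.face := by
  have := Fintype.ofFinite E'
  let C : Finset (E' × E') := Finset.univ.filter fun q => H'.Adj q.1 q.2 ∧ D.proj q.1 = D.proj q.2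
  have hC (x) (hx : x ∈ stablePolytope H') (q : E' × E') (hq : q ∈ C) : x q.1 + x q.2 ≤ 1 :=
    add_le_one_of_mem_stablePolytope hx (Finset.mem_filter.1 hq).2.1
  let l : (E' → ℝ) →ₗ[ℝ] ℝ := ∑ q ∈ C, (LinearMap.proj (R := ℝ) (φ := fun _ : E' => ℝ) q.1 +
    LinearMap.proj (R := ℝ) (φ := fun _ : E' => ℝ) q.2)
  have hl (x : E' → ℝ) : l x = ∑ q ∈ C, (x q.1 + x q.2) := by
    simp [l, LinearMap.sum_apply]
  refine ⟨l, ∑ q ∈ C, 1, fun x hx => ?_, fun x hx => ?_⟩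
  · rw [hl]; exact Finset.sum_le_sum (hC x hx)
  · rw [hl, Finset.sum_eq_sum_iff_of_le (hC x hx)]
    refine ⟨fun h => ⟨hx, fun e' f' hadj hp => h (e', f') (by simp [C, hadj, hp])⟩, fun h q hq => ?_⟩
    exact h.2 _ _ (Finset.mem_filter.1 hq).2.1 (Finset.mem_filter.1 hq).2.2

/-- Needed to know that the upper bound of the supporting functional is attained. -/
lemma face_nonempty : D.face.Nonempty :=
  ⟨_, D.inflate_mem_face (a := fun _ => 0)
    (natCast_mem_stablePolytope_iff.2 ⟨fun _ => zero_le_one, fun _ _ _ => zero_le_one⟩)⟩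

lemma isExposed_face [Finite E'] : IsExposed ℝ (stablePolytope H') D.face := by
  intro _
  obtain ⟨l, c, hle, hc⟩ := D.exists_linearMap
  obtain ⟨x₀, hx₀⟩ := D.face_nonempty
  refine ⟨LinearMap.toContinuousLinearMap l, Set.ext fun x => ⟨fun hx => ⟨hx.1, fun y hy => ?_⟩,
    fun ⟨hx, hxl⟩ => ?_⟩⟩
  · exact (hle y hy).trans ((hc x hx.1).2 hx).ge
  · exact (hc x hx).1 ((hle x hx).antisymm (((hc x₀ hx₀.1).2 hx₀).ge.trans (hxl x₀ hx₀.1)))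

lemma face_eq_convexHull [Finite E'] :
    D.face = convexHull ℝ {x | x ∈ D.face ∧ ∃ a : E' → ℕ, x = fun e => (a e : ℝ)} := by
  obtain ⟨l, c, hle, hc⟩ := D.exists_linearMap
  refine Set.Subset.antisymm (fun x hx => ?_) (convexHull_min (fun x hx => hx.1) ?_)
  · refine convexHull_mono ?_ (mem_convexHull_of_linearMap_eq l
      (fun y hy => hle y (subset_convexHull ℝ _ hy)) hx.1 ((hc x hx.1).2 hx))
    rintro y ⟨hy, hyc⟩
    refine ⟨(hc y (subset_convexHull ℝ _ hy)).1 hyc, ?_⟩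
    obtain ⟨M, -, rfl⟩ := hy
    classical
    exact ⟨fun e => if e ∈ M then 1 else 0, funext fun e => by simp [Set.indicator]⟩
  · have : D.face = stablePolytope H' ∩ {x | l x = c} := Set.ext fun x =>
      ⟨fun hx => ⟨hx.1, (hc x hx.1).2 hx⟩, fun hx => (hc x hx.1).1 hx.2⟩
    rw [this]
    exact (convex_convexHull ℝ _).inter (convex_hyperplane l.isLinear c)

lemma stablePolytope_eq_convexHull :
    stablePolytope H = convexHull ℝ {x | x ∈ stablePolytope H ∧ ∃ a : E → ℕ, x = fun e => (a e : ℝ)} := by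
  refine Set.Subset.antisymm (convexHull_mono ?_)
    (convexHull_min (fun x hx => hx.1) (convex_convexHull ℝ _))
  intro y hy
  refine ⟨subset_convexHull ℝ _ hy, ?_⟩
  obtain ⟨M, -, rfl⟩ := hy
  classical
  exact ⟨fun e => if e ∈ M then 1 else 0, funext fun e => by simp [Set.indicator]⟩

/-- The projection to the coordinates of the first vertices of the paths. -/
def restrict : (E' → ℝ) →ᵃ[ℝ] (E → ℝ) :=
  (LinearMap.funLeft ℝ ℝ D.base).toAffineMap

lemma restrict_apply (x : E' → ℝ) (e : E) : D.restrict x e = x (D.base e) := rfl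

/-- Affine maps commute with convex hulls, so it suffices to match lattice points, where `inflate`
inverts the restriction. -/
lemma image_restrict_face [Finite E'] : D.restrict '' D.face = stablePolytope H := by
  rw [D.face_eq_convexHull, AffineMap.image_convexHull, stablePolytope_eq_convexHull]
  congr 1
  ext y
  constructor
  · rintro ⟨_, ⟨hx, a, rfl⟩, rfl⟩
    exact ⟨D.comp_base_mem_stablePolytope hx, a ∘ D.base, rfl⟩
  · rintro ⟨hy, a, rfl⟩
    exact ⟨_, ⟨D.inflate_mem_face hy, _, rfl⟩, funext fun e => by
      rw [D.restrict_apply, D.inflate_base]⟩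

lemma add_eq_one_of_mem_affineSpan {x : E' → ℝ} (hx : x ∈ affineSpan ℝ D.face) {e' f' : E'}
    (h : H'.Adj e' f') (hp : D.proj e' = D.proj f') : x e' + x f' = 1 := by
  refine affineSpan_induction (p := fun x : E' → ℝ => x e' + x f' = 1) hx
    (fun x hx => hx.2 _ _ h hp) fun c u v w hu hv hw => ?_
  simp only [vsub_eq_sub, vadd_eq_add, Pi.add_apply, Pi.smul_apply, Pi.sub_apply, smul_eq_mul]
  linear_combination c * hu - c * hv + hw

/-- The defining equations persist on the affine hull, so every coordinate is `t` or `1 - t` for a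
base coordinate `t`. This gives injectivity and transfers integrality. -/
lemma unimodularlyIsomorphic_face [Finite E'] :
    UnimodularlyIsomorphic D.face (stablePolytope H) := by
  have halt {x : E' → ℝ} (hx : x ∈ affineSpan ℝ D.face) :=
    D.alternate x fun e' f' => D.add_eq_one_of_mem_affineSpan hx
  refine ⟨D.restrict, fun x hx y hy hxy => funext fun e' => ?_, D.image_restrict_face,
    Set.Subset.antisymm ?_ ?_⟩
  · have := congrFun hxy (D.proj e')
    simp only [D.restrict_apply] at this
    by_cases h : D.odd e'
    · rw [(halt hx e').1 h, (halt hy e').1 h, this]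
    · rw [(halt hx e').2 h, (halt hy e').2 h, this]
  · rintro _ ⟨x, ⟨hx, hxi⟩, rfl⟩
    refine ⟨?_, fun e => hxi (D.base e)⟩
    rw [← D.image_restrict_face, ← AffineSubspace.map_span]
    exact ⟨x, hx, rfl⟩
  · rintro y ⟨hy, hyi⟩
    rw [← D.image_restrict_face, ← AffineSubspace.map_span] at hy
    obtain ⟨x, hx, rfl⟩ := hy
    refine ⟨x, ⟨hx, fun e' => ?_⟩, rfl⟩
    obtain ⟨n, hn⟩ := hyi (D.proj e')
    have hn' : x (D.base (D.proj e')) = n := hn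
    by_cases h : D.odd e'
    · exact ⟨n, by rw [(halt hx e').1 h, hn']⟩
    · exact ⟨1 - n, by rw [(halt hx e').2 h, hn']; push_cast; rfl⟩

/-! ### The toric ideal of the face as a retract. -/

section Toric

variable {K : Type*} [Field K] [Finite E']

/-- The lattice points of the stable set polytope of `H` as lattice points of the face. -/
noncomputable def liftPoint (a : LatticePoint (stablePolytope H)) :
    LatticePoint (stablePolytope H') :=
  ⟨Finsupp.equivFunOnFinite.symm (D.inflate a.1), D.inflate_mem_stablePolytope a.2⟩

lemma liftPoint_apply (a : LatticePoint (stablePolytope H)) (e' : E') :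
    (D.liftPoint a).1 e' = D.inflate a.1 e' := rfl

lemma liftPoint_injective : Function.Injective D.liftPoint := fun a b h =>
  Subtype.ext <| Finsupp.ext fun e => by
    have := DFunLike.congr_fun (congrArg Subtype.val h) (D.base e)
    rwa [liftPoint_apply, liftPoint_apply, D.inflate_base, D.inflate_base] at this

lemma mem_range_liftPoint [Finite E] {a : LatticePoint (stablePolytope H')}
    (ha : (fun e => (a.1 e : ℝ)) ∈ D.face) : a ∈ Set.range D.liftPoint :=
  ⟨⟨Finsupp.equivFunOnFinite.symm (a.1 ∘ D.base), D.comp_base_mem_stablePolytope ha⟩,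
    Subtype.ext <| Finsupp.ext fun e' => congrFun (D.inflate_comp_base ha) e'⟩

open Classical in
/-- The homomorphism that kills the variables outside of the face. -/
noncomputable def faceHom (K : Type*) [Field K] :
    MvPolynomial (LatticePoint (stablePolytope H')) K →ₐ[K]
      MvPolynomial (LatticePoint (stablePolytope H)) K :=
  aeval fun a => if h : ∃ b, D.liftPoint b = a then X h.choose else 0

lemma faceHom_X_liftPoint (a : LatticePoint (stablePolytope H)) :
    D.faceHom K (X (D.liftPoint a)) = X a := by
  have h : ∃ b, D.liftPoint b = D.liftPoint a := ⟨a, rfl⟩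
  rw [faceHom, aeval_X, dif_pos h, D.liftPoint_injective h.choose_spec]

lemma faceHom_X_of_notMem_range {a : LatticePoint (stablePolytope H')}
    (ha : a ∉ Set.range D.liftPoint) : D.faceHom K (X a) = 0 := by
  rw [faceHom, aeval_X]
  exact dif_neg ha

lemma faceHom_rename (f : MvPolynomial (LatticePoint (stablePolytope H)) K) :
    D.faceHom K (rename D.liftPoint f) = f := by
  have : (D.faceHom K).comp (rename D.liftPoint) = AlgHom.id K _ :=
    MvPolynomial.algHom_ext fun a => by simp [faceHom_X_liftPoint]
  exact DFunLike.congr_fun this f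

lemma isHomogeneous_faceHom {f : MvPolynomial (LatticePoint (stablePolytope H')) K} {n : ℕ}
    (hf : f.IsHomogeneous n) : (D.faceHom K f).IsHomogeneous n := by
  rw [← one_mul n]
  refine hf.aeval _ fun a => ?_
  split_ifs
  · exact isHomogeneous_X _ _
  · exact isHomogeneous_zero _ _ _

lemma toricExponent_mapDomain_some (m : LatticePoint (stablePolytope H) →₀ ℕ) (e' : E') :
    toricExponent (m.mapDomain D.liftPoint) (some e') =
      m.sum fun a k => k * D.inflate a.1 e' := by
  rw [toricExponent_some, Finsupp.sum_mapDomain_index (by simp) (by intros; ring)]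
  rfl

lemma toricExponent_mapDomain_none (m : LatticePoint (stablePolytope H) →₀ ℕ) :
    toricExponent (m.mapDomain D.liftPoint) none = toricExponent m none := by
  rw [toricExponent_none, toricExponent_none,
    Finsupp.sum_mapDomain_index (fun _ => rfl) (fun _ _ _ => rfl)]

open Classical in
/-- The exponent vector on `E'` that corresponds to an exponent vector on `E`. -/
noncomputable def inflateExponent (b : Option E →₀ ℕ) : Option E' →₀ ℕ :=
  Finsupp.equivFunOnFinite.symm fun
    | none => b none
    | some e' => if D.odd e' then b (some (D.proj e')) else b none - b (some (D.proj e'))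

open Classical in
-- In even position each factor contributes `1 - a`, in total the degree minus the base exponent.
-- Hence the new exponent depends only on the old one.
lemma toricExponent_mapDomain (m : LatticePoint (stablePolytope H) →₀ ℕ) :
    toricExponent (m.mapDomain D.liftPoint) = D.inflateExponent (toricExponent m) := by
  ext (_ | e')
  · exact D.toricExponent_mapDomain_none m
  · rw [toricExponent_mapDomain_some]
    change _ = if D.odd e' then toricExponent m (some (D.proj e'))
      else toricExponent m none - toricExponent m (some (D.proj e'))
    rw [toricExponent_some, toricExponent_none]
    split_ifs with h
    · simp [inflate, h]
    · refine eq_tsub_of_add_eq ?_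
      rw [← Finsupp.sum_add]
      refine Finsupp.sum_congr fun a _ => ?_
      have := (natCast_mem_stablePolytope_iff.1 a.2).1 (D.proj e')
      rw [inflate, if_neg h, ← mul_add, Nat.sub_add_cancel this, mul_one]

lemma rename_mem_toricIdeal {f : MvPolynomial (LatticePoint (stablePolytope H)) K}
    (hf : f ∈ toricIdeal K (stablePolytope H)) :
    rename D.liftPoint f ∈ toricIdeal K (stablePolytope H') := by
  have h : (toricMap K (stablePolytope H')).toLinearMap ∘ₗ (rename D.liftPoint).toLinearMap =
      monomialLinearMap (K := K) (fun b => monomial (D.inflateExponent b) (1 : K)) ∘ₗ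
        (toricMap K (stablePolytope H)).toLinearMap := by
    refine linearMap_ext_monomial fun m => ?_
    simp only [LinearMap.comp_apply, AlgHom.toLinearMap_apply, rename_monomial, toricMap_monomial,
      monomialLinearMap_monomial, toricExponent_mapDomain]
  have := LinearMap.congr_fun h f
  simp only [LinearMap.comp_apply, AlgHom.toLinearMap_apply, mem_toricIdeal.1 hf, map_zero] at this
  exact mem_toricIdeal.2 this

/-- The exponent vectors of degree `n` in the `n`-th multiple of the face. -/
def IsFaceExponent (b : Option E' →₀ ℕ) : Prop :=
  ∀ e' f', H'.Adj e' f' → D.proj e' = D.proj f' → b (some e') + b (some f') = b none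

/-- Each factor adds at most `1` to the sum of two adjacent exponents, so the sum reaches the degree
only if all factors are tight. Thus the image of a monomial already decides whether `faceHom` kills
it. -/
lemma isFaceExponent_toricExponent_iff [Finite E]
    (m : LatticePoint (stablePolytope H') →₀ ℕ) :
    D.IsFaceExponent (toricExponent m) ↔ ∀ a ∈ m.support, a ∈ Set.range D.liftPoint := by
  have key {e' f'} (hadj : H'.Adj e' f') :
      toricExponent m (some e') + toricExponent m (some f') = toricExponent m none ↔
        ∀ a ∈ m.support, a.1 e' + a.1 f' = 1 := by
    have hle (a : LatticePoint (stablePolytope H')) : a.1 e' + a.1 f' ≤ 1 :=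
      (natCast_mem_stablePolytope_iff.1 a.2).2 _ _ hadj
    rw [toricExponent_some, toricExponent_some, toricExponent_none, ← Finsupp.sum_add,
      Finsupp.sum, Finsupp.sum, Finset.sum_eq_sum_iff_of_le]
    · refine forall₂_congr fun a ha => ?_
      have := Finsupp.mem_support_iff.1 ha
      rw [← mul_add, mul_eq_left₀ this]
    · intro a _
      rw [← mul_add]
      exact mul_le_of_le_one_right (Nat.zero_le _) (hle a)
  constructor
  · intro h a ha
    refine D.mem_range_liftPoint ⟨a.2, fun e' f' hadj hp => ?_⟩
    beta_reduce
    exact_mod_cast (key hadj).1 (h e' f' hadj hp) a ha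
  · intro h e' f' hadj hp
    refine (key hadj).2 fun a ha => ?_
    obtain ⟨b, rfl⟩ := h a ha
    exact D.inflate_add_inflate (natCast_mem_stablePolytope_iff.1 b.2).1 hadj hp

lemma faceHom_monomial_eq_zero {m : LatticePoint (stablePolytope H') →₀ ℕ}
    (hm : ¬ ∀ a ∈ m.support, a ∈ Set.range D.liftPoint) : D.faceHom K (monomial m 1) = 0 := by
  push Not at hm
  obtain ⟨a, ha, har⟩ := hm
  have h : (X a : MvPolynomial _ K) ∣ monomial m 1 :=
    X_dvd_monomial.2 (Or.inr (Finsupp.mem_support_iff.1 ha))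
  have := map_dvd (D.faceHom K) h
  rwa [D.faceHom_X_of_notMem_range har, zero_dvd_iff] at this

/-- The exponent vector on `E` with the coordinates of the first vertices of the paths. -/
noncomputable def restrictExponent [Finite E] (b : Option E' →₀ ℕ) : Option E →₀ ℕ :=
  Finsupp.equivFunOnFinite.symm fun o => b (o.map D.base)

open Classical in
lemma faceHom_mem_toricIdeal [Finite E] {f : MvPolynomial (LatticePoint (stablePolytope H')) K}
    (hf : f ∈ toricIdeal K (stablePolytope H')) :
    D.faceHom K f ∈ toricIdeal K (stablePolytope H) := by
  have h : (toricMap K (stablePolytope H)).toLinearMap ∘ₗ (D.faceHom K).toLinearMap =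
      monomialLinearMap (K := K) (fun b =>
        if D.IsFaceExponent b then monomial (D.restrictExponent b) (1 : K) else 0) ∘ₗ
        (toricMap K (stablePolytope H')).toLinearMap := by
    refine linearMap_ext_monomial fun m => ?_
    simp only [LinearMap.comp_apply, AlgHom.toLinearMap_apply, toricMap_monomial,
      monomialLinearMap_monomial, isFaceExponent_toricExponent_iff]
    split_ifs with hm
    · obtain ⟨m, rfl⟩ : ∃ m₀, Finsupp.mapDomain D.liftPoint m₀ = m :=
        ⟨_, Finsupp.mapDomain_comapDomain _ D.liftPoint_injective m hm⟩
      rw [← rename_monomial, faceHom_rename, toricMap_monomial]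
      refine congrArg (fun b => monomial b (1 : K)) (Finsupp.ext ?_)
      rintro (_ | e)
      · exact (D.toricExponent_mapDomain_none m).symm
      · refine Eq.trans ?_ (D.toricExponent_mapDomain_some m (D.base e)).symm
        simp only [toricExponent_some, inflate_base]
    · rw [D.faceHom_monomial_eq_zero hm, map_zero]
  have := LinearMap.congr_fun h f
  simp only [LinearMap.comp_apply, AlgHom.toLinearMap_apply, mem_toricIdeal.1 hf, map_zero] at this
  exact mem_toricIdeal.2 this

lemma map_faceHom_toricIdeal [Finite E] :
    (toricIdeal K (stablePolytope H')).map (D.faceHom K).toRingHom =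
      toricIdeal K (stablePolytope H) := by
  refine le_antisymm (Ideal.map_le_iff_le_comap.2 fun f hf => D.faceHom_mem_toricIdeal hf)
    fun f hf => ?_
  rw [← D.faceHom_rename f]
  exact Ideal.mem_map_of_mem (D.faceHom K).toRingHom (D.rename_mem_toricIdeal hf)

lemma omegaDegree_toricIdeal_le (D : VertexInflation H H') [Finite E] (K : Type*) [Field K] :
    omegaDegree (toricIdeal K (stablePolytope H)) ≤
      omegaDegree (toricIdeal K (stablePolytope H')) := by
  have := finite_latticePoint_stablePolytope H'
  exact omegaDegree_map_le (fun f hf n => homogeneousComponent_mem_toricIdeal hf n)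
    (fun f hf n hn h => eq_zero_of_mem_toricIdeal_of_isHomogeneous hf hn h)
    (D.faceHom K).toRingHom D.map_faceHom_toricIdeal fun f n h => D.isHomogeneous_faceHom h

end Toric

end VertexInflation

/-! ### The line graph of an odd subdivision. -/

namespace OddSubdivision

variable {V W : Type*} {G : SimpleGraph V} {G' : SimpleGraph W}

lemma mem_edges_path_iff (D : OddSubdivision G G') {u v a b : V} (h : G.Adj u v) (k : G.Adj a b)
    (hk : s(u, v) = s(a, b)) (e' : Sym2 W) : e' ∈ (D.path h).edges ↔ e' ∈ (D.path k).edges := by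
  obtain ⟨rfl, rfl⟩ | ⟨rfl, rfl⟩ := Sym2.eq_iff.1 hk
  · rfl
  · rw [D.path_symm h, SimpleGraph.Walk.edges_reverse, List.mem_reverse]

/-- The first end of an edge, for an arbitrary orientation of the edges. -/
noncomputable def src (e : G.edgeSet) : V := (Quot.out e.1).1

/-- The second end of an edge, for an arbitrary orientation of the edges. -/
noncomputable def tgt (e : G.edgeSet) : V := (Quot.out e.1).2

lemma mk_src_tgt (e : G.edgeSet) : s(src e, tgt e) = e.1 := Quot.out_eq e.1

lemma adj_src_tgt (e : G.edgeSet) : G.Adj (src e) (tgt e) := by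
  have := e.2
  rwa [← mk_src_tgt e, SimpleGraph.mem_edgeSet] at this

variable (D : OddSubdivision G G')

/-- The length of the path that replaces an edge. -/
noncomputable def len (e : G.edgeSet) : ℕ := (D.path (adj_src_tgt e)).length

/-- The vertices of the path that replaces an edge. -/
noncomputable def vtx (e : G.edgeSet) (i : ℕ) : W := (D.path (adj_src_tgt e)).getVert i

/-- The edges of the path that replaces an edge. -/
noncomputable def pathEdge (e : G.edgeSet) (i : ℕ) : Sym2 W := s(D.vtx e i, D.vtx e (i + 1))

lemma odd_len (e : G.edgeSet) : Odd (D.len e) := D.odd_length _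

lemma vtx_zero (e : G.edgeSet) : D.vtx e 0 = D.vert (src e) := SimpleGraph.Walk.getVert_zero _

lemma vtx_len (e : G.edgeSet) : D.vtx e (D.len e) = D.vert (tgt e) :=
  SimpleGraph.Walk.getVert_length _

lemma vtx_inj {e : G.edgeSet} {i j : ℕ} (hi : i ≤ D.len e) (hj : j ≤ D.len e)
    (h : D.vtx e i = D.vtx e j) : i = j :=
  (D.isPath (adj_src_tgt e)).getVert_injOn hi hj h

lemma vtx_mem_support (e : G.edgeSet) (i : ℕ) :
    D.vtx e i ∈ (D.path (adj_src_tgt e)).support :=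
  SimpleGraph.Walk.getVert_mem_support _ _

lemma eq_zero_or_len_of_vtx_eq_vert {e : G.edgeSet} {i : ℕ} (hi : i ≤ D.len e) {x : V}
    (h : D.vtx e i = D.vert x) : (i = 0 ∧ x = src e) ∨ (i = D.len e ∧ x = tgt e) := by
  obtain hx | hx := D.inner_new (adj_src_tgt e) x (h ▸ D.vtx_mem_support e i)
  · refine Or.inl ⟨D.vtx_inj hi (Nat.zero_le _) ?_, hx⟩
    rw [h, D.vtx_zero, hx]
  · refine Or.inr ⟨D.vtx_inj hi le_rfl ?_, hx⟩
    rw [h, D.vtx_len, hx]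

lemma exists_vert_eq_of_vtx_eq {e f : G.edgeSet} (hef : e ≠ f) {i j : ℕ}
    (h : D.vtx e i = D.vtx f j) : ∃ x, D.vtx e i = D.vert x := by
  have hne : s(src e, tgt e) ≠ s(src f, tgt f) := by
    rw [mk_src_tgt, mk_src_tgt]; exact fun h => hef (Subtype.ext h)
  obtain ⟨x, hx⟩ := D.inner_disjoint (adj_src_tgt e) (adj_src_tgt f) hne _
    (D.vtx_mem_support e i) (h ▸ D.vtx_mem_support f j)
  exact ⟨x, hx.symm⟩

lemma pathEdge_mem {e : G.edgeSet} {i : ℕ} (hi : i < D.len e) : D.pathEdge e i ∈ G'.edgeSet :=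
  SimpleGraph.Walk.adj_getVert_succ _ hi

lemma exists_pathEdge_eq (e' : G'.edgeSet) :
    ∃ (e : G.edgeSet) (i : ℕ), i < D.len e ∧ D.pathEdge e i = e'.1 := by
  obtain ⟨u, v, h, he⟩ := D.edge_cover e'.1 e'.2
  let e : G.edgeSet := ⟨s(u, v), h⟩
  rw [D.mem_edges_path_iff h (adj_src_tgt e) (mk_src_tgt e).symm] at he
  revert he
  induction e'.1 with
  | _ a b =>
    intro he
    obtain ⟨i, hi, hil⟩ := (SimpleGraph.Walk.mk_mem_edges_iff_exists _).1 he
    exact ⟨e, i, hi, hil⟩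

/-- A vertex at which two paths meet is the end of both. -/
lemma mem_of_vtx_eq {e f : G.edgeSet} (hef : e ≠ f) {i j : ℕ} (hi : i ≤ D.len e)
    (hj : j ≤ D.len f) (h : D.vtx e i = D.vtx f j) :
    (∃ x, x ∈ e.1 ∧ x ∈ f.1) ∧ (i = 0 ∨ i = D.len e) ∧ (j = 0 ∨ j = D.len f) := by
  obtain ⟨x, hx⟩ := D.exists_vert_eq_of_vtx_eq hef h
  have h1 := D.eq_zero_or_len_of_vtx_eq_vert hi hx
  have h2 := D.eq_zero_or_len_of_vtx_eq_vert hj (h.symm.trans hx)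
  refine ⟨⟨x, ?_, ?_⟩, by tauto, by tauto⟩
  · rw [← mk_src_tgt e, Sym2.mem_iff]; tauto
  · rw [← mk_src_tgt f, Sym2.mem_iff]; tauto

/-- An edge shared by two different paths would have both its vertices at ends of both paths. Both
paths would then have length `1` and replace the same edge of `G`. -/
lemma pathEdge_inj {e f : G.edgeSet} {i j : ℕ} (hi : i < D.len e) (hj : j < D.len f)
    (h : D.pathEdge e i = D.pathEdge f j) : e = f ∧ i = j := by
  have h' := Sym2.eq_iff.1 h
  by_cases hef : e = f
  · subst hef
    refine ⟨rfl, ?_⟩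
    obtain ⟨h1, -⟩ | ⟨h1, h2⟩ := h'
    · exact D.vtx_inj hi.le hj.le h1
    · have := D.vtx_inj hi.le hj h1
      have := D.vtx_inj hi hj.le h2
      omega
  · exfalso
    have key {k l : ℕ} (hk : k ≤ D.len e) (hl : l ≤ D.len f) (hkl : D.vtx e k = D.vtx f l) :=
      (D.mem_of_vtx_eq hef hk hl hkl).2
    have hends : i = 0 ∧ i + 1 = D.len e ∧ j = 0 ∧ j + 1 = D.len f := by
      obtain ⟨h1, h2⟩ | ⟨h1, h2⟩ := h'
      · have := key hi.le hj.le h1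
        have := key hi hj h2
        omega
      · have := key hi.le hj h1
        have := key hi hj.le h2
        omega
    obtain ⟨rfl, h1, rfl, h2⟩ := hends
    rw [pathEdge, pathEdge, h1, vtx_zero, vtx_zero, vtx_len, h1.symm.trans h2, vtx_len] at h
    have : s(src e, tgt e) = s(src f, tgt f) := Sym2.map.injective D.vert.injective h
    rw [mk_src_tgt, mk_src_tgt] at this
    exact hef (Subtype.ext this)

/-- The edge whose path contains the given edge of the subdivision. -/
noncomputable def origin (e' : G'.edgeSet) : G.edgeSet := (D.exists_pathEdge_eq e').choose

/-- The position of an edge of the subdivision on its path. -/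
noncomputable def position (e' : G'.edgeSet) : ℕ := (D.exists_pathEdge_eq e').choose_spec.choose

lemma position_lt (e' : G'.edgeSet) : D.position e' < D.len (D.origin e') :=
  (D.exists_pathEdge_eq e').choose_spec.choose_spec.1

lemma pathEdge_origin_position (e' : G'.edgeSet) :
    D.pathEdge (D.origin e') (D.position e') = e'.1 :=
  (D.exists_pathEdge_eq e').choose_spec.choose_spec.2

lemma origin_position_mk {e : G.edgeSet} {i : ℕ} (hi : i < D.len e) :
    D.origin ⟨_, D.pathEdge_mem hi⟩ = e ∧ D.position ⟨_, D.pathEdge_mem hi⟩ = i :=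
  D.pathEdge_inj (D.position_lt _) hi (D.pathEdge_origin_position _)

lemma len_pos (e : G.edgeSet) : 0 < D.len e := (D.odd_len e).pos

lemma exists_vtx_eq_of_mem {e' : G'.edgeSet} {w : W} (hw : w ∈ e'.1) :
    ∃ k, (k = D.position e' ∨ k = D.position e' + 1) ∧ k ≤ D.len (D.origin e') ∧
      D.vtx (D.origin e') k = w := by
  have := D.position_lt e'
  rw [← D.pathEdge_origin_position e', pathEdge, Sym2.mem_iff] at hw
  obtain rfl | rfl := hw
  · exact ⟨_, Or.inl rfl, this.le, rfl⟩
  · exact ⟨_, Or.inr rfl, this, rfl⟩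

/-- Here odd length enters: with positions counted from `0`, the last edge has the even position
`len - 1`. -/
lemma even_position_of_end {e' : G'.edgeSet} {k : ℕ}
    (hk : k = D.position e' ∨ k = D.position e' + 1) (h : k = 0 ∨ k = D.len (D.origin e')) :
    Even (D.position e') := by
  have h1 := D.position_lt e'
  obtain ⟨m, hm⟩ := D.odd_len (D.origin e')
  rw [Nat.even_iff]
  omega

/-- An end edge, in even position, of the path of `e` at a given end of `e`. -/
lemma exists_even_of_mem {e : G.edgeSet} {x : V} (hx : x ∈ e.1) :
    ∃ e' : G'.edgeSet, D.origin e' = e ∧ Even (D.position e') ∧ D.vert x ∈ e'.1 := by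
  rw [← mk_src_tgt e, Sym2.mem_iff] at hx
  have hpos := D.len_pos e
  obtain rfl | rfl := hx
  · obtain ⟨h1, h2⟩ := D.origin_position_mk hpos
    exact ⟨_, h1, by rw [h2]; exact Even.zero, by
      rw [← D.vtx_zero]; exact Sym2.mem_mk_left _ _⟩
  · obtain ⟨h1, h2⟩ := D.origin_position_mk (Nat.sub_lt hpos one_pos)
    refine ⟨_, h1, by rw [h2]; exact (D.odd_len e).tsub_odd odd_one, ?_⟩
    have h3 : D.vtx e (D.len e - 1 + 1) = D.vert (tgt e) := by
      rw [Nat.sub_add_cancel (Nat.succ_le_of_lt hpos), D.vtx_len]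
    exact h3 ▸ Sym2.mem_mk_right _ _

/-- The coordinates along a path alternate if consecutive coordinates sum to `1`. -/
lemma alternate_pathEdge {x : G'.edgeSet → ℝ}
    (hx : ∀ e' f', G'.lineGraph.Adj e' f' → D.origin e' = D.origin f' → x e' + x f' = 1)
    (e : G.edgeSet) (i : ℕ) (hi : i < D.len e) :
    (Even i → x ⟨_, D.pathEdge_mem hi⟩ = x ⟨_, D.pathEdge_mem (D.len_pos e)⟩) ∧
      (¬ Even i → x ⟨_, D.pathEdge_mem hi⟩ = 1 - x ⟨_, D.pathEdge_mem (D.len_pos e)⟩) := by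
  induction i with
  | zero => exact ⟨fun _ => rfl, fun h => absurd Even.zero h⟩
  | succ i ih =>
    have hi' : i < D.len e := (Nat.lt_succ_self i).trans hi
    obtain ⟨h1, h2⟩ := ih hi'
    have h3 : x ⟨_, D.pathEdge_mem hi'⟩ + x ⟨_, D.pathEdge_mem hi⟩ = 1 := by
      refine hx _ _ (SimpleGraph.lineGraph_adj_iff_exists.2 ⟨fun h => ?_, D.vtx e (i + 1),
        Sym2.mem_mk_right _ _, Sym2.mem_mk_left _ _⟩) ?_
      · have := (D.pathEdge_inj hi' hi (congrArg Subtype.val h)).2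
        omega
      · rw [(D.origin_position_mk hi').1, (D.origin_position_mk hi).1]
    rw [Nat.even_add_one]
    constructor
    · intro h; linarith [h2 h]
    · intro h; linarith [h1 (not_not.1 h)]

/-- The line graph of an odd subdivision. The first edge of a path is in position `0`. -/
noncomputable def vertexInflation : VertexInflation G.lineGraph G'.lineGraph where
  proj := D.origin
  odd e' := Even (D.position e')
  base e := ⟨D.pathEdge e 0, D.pathEdge_mem (D.len_pos e)⟩
  proj_base e := (D.origin_position_mk (D.len_pos e)).1
  odd_base e := by rw [(D.origin_position_mk (D.len_pos e)).2]; exact Even.zero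
  adj {e' f'} h := by
    obtain ⟨hne, w, he, hf⟩ := SimpleGraph.lineGraph_adj_iff_exists.1 h
    obtain ⟨k, hk, hkl, rfl⟩ := D.exists_vtx_eq_of_mem he
    obtain ⟨l, hl, hll, hkw⟩ := D.exists_vtx_eq_of_mem hf
    by_cases hef : D.origin e' = D.origin f'
    · refine Or.inl ⟨hef, ?_⟩
      have hpos : D.position e' ≠ D.position f' := fun h' => hne <| Subtype.ext <| by
        rw [← D.pathEdge_origin_position e', ← D.pathEdge_origin_position f', hef, h']
      rw [hef] at hkl hkw
      -- The common vertex has the same index for both edges, so their distinct positions differ by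
      -- one.
      have := D.vtx_inj hll hkl hkw
      rw [Nat.even_iff, Nat.even_iff]
      omega
    · obtain ⟨hx, h1, h2⟩ := D.mem_of_vtx_eq hef hkl hll hkw.symm
      exact Or.inr ⟨SimpleGraph.lineGraph_adj_iff_exists.2 ⟨hef, hx⟩,
        D.even_position_of_end hk h1, D.even_position_of_end hl h2⟩
  lift_adj {e f} h := by
    obtain ⟨hne, x, he, hf⟩ := SimpleGraph.lineGraph_adj_iff_exists.1 h
    obtain ⟨e', rfl, h1, h2⟩ := D.exists_even_of_mem he
    obtain ⟨f', rfl, h3, h4⟩ := D.exists_even_of_mem hf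
    exact ⟨e', f', SimpleGraph.lineGraph_adj_iff_exists.2
      ⟨fun h => hne (h ▸ rfl), D.vert x, h2, h4⟩, rfl, rfl, h1, h3⟩
  alternate x hx e' := by
    have h := D.alternate_pathEdge hx (D.origin e') (D.position e') (D.position_lt e')
    have he : (⟨_, D.pathEdge_mem (D.position_lt e')⟩ : G'.edgeSet) = e' :=
      Subtype.ext (D.pathEdge_origin_position e')
    rwa [he] at h

end OddSubdivision

theorem proposition5 {V W : Type*} [Finite V] [Finite W]
    (G : SimpleGraph V) (G' : SimpleGraph W) (hG' : IsOddSubdivision G G') :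
    (∃ F : Set (G'.edgeSet → ℝ), IsExposed ℝ (matchingPolytope G') F ∧
      UnimodularlyIsomorphic F (matchingPolytope G)) ∧
    ∀ (K : Type*) [Field K],
      omegaDegree (toricIdeal K (matchingPolytope G)) ≤
        omegaDegree (toricIdeal K (matchingPolytope G')) := by
  obtain ⟨D⟩ := hG'
  rw [matchingPolytope_eq_stablePolytope, matchingPolytope_eq_stablePolytope]
  exact ⟨⟨_, D.vertexInflation.isExposed_face, D.vertexInflation.unimodularlyIsomorphic_face⟩,
    fun K _ => D.vertexInflation.omegaDegree_toricIdeal_le K⟩
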